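/- Let $\mathbb F_q$ be a finite field, let $k,n\ge 0$ be integers, let $G\in\mathbb F_q^{k\times n}$, write $c(x)=x^TG$ for $x\in\mathbb F_q^k$, and let $\mathcal C=\{c(x):x\in\mathbb F_q^k\}\subseteq\mathbb F_q^n$ be the linear code generated by $G$, of size $N=|\mathcal C|$. For a nonempty $\Lambda\subseteq\mathbb F_q^k$ and $j\in[n]$ let $$\mathrm{pl}_j(\Lambda)=\frac1{|\Lambda|}\max_{\alpha\in\mathbb F_q}\bigl|\{x\in\Lambda: c(x)_j=\alpha\}\bigr|.$$ For an integer $L$ with $1\le L\le q^k$ let $$\mathcal S_0=\{[n]\}\times\{\Lambda\subseteq\mathbb F_q^k:|\Lambda|=L\},\qquad Q=\max_{|\Lambda|=L}\sum_{j\in[n]}\mathrm{pl}_j(\Lambda).$$ Let $g=(g_1,\dots,g_n)$ be a vector of independent standard normal random variables (the code is fixed, and the only randomness is that of $g$), and let $X(I,\Lambda)=\sum_{j\in I}g_j\,\mathrm{pl}_j(\Lambda)$. Then there is an absolute constant $C_3>0$ such that for all $q,k,n,G,L$ as above with $N\ge 2$ and $2\le L\le q^k$, the random variable $\max_{(I,\Lambda)\in\mathcal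 S_0}|X(I,\Lambda)|$ is integrable and $$\mathbb E_g\max_{(I,\Lambda)\in\mathcal S_0}|X(I,\Lambda)|\le C_3\sqrt{Q\,\log (N)\,\log^5 (L)},$$ where $\log$ is the logarithm to base $2$ and $\log^5(L)=(\log L)^5$. -/

import Mathlib

open MeasureTheory ProbabilityTheory
open scoped Matrix

namespace ListDecoding

theorem powersetCard_nonempty {K : Type*} [Fintype K] {k L : ℕ} (hL : L ≤ Fintype.card K ^ k) :
    (Finset.powersetCard L (Finset.univ : Finset (Fin k → K))).Nonempty := by
  rw [Finset.powersetCard_nonempty]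
  simpa using hL

section Definitions

variable {F : Type*} [Field F] {k n : ℕ}

/-- The encoding `c(x) = xᵀ G` of a message `x ∈ F^k` with the generator matrix `G ∈ F^{k × n}`. -/
def encode (G : Matrix (Fin k) (Fin n) F) (x : Fin k → F) : Fin n → F :=
  x ᵥ* G

/-- The linear code `𝒞 = {xᵀ G : x ∈ F^k} ⊆ F^n` generated by `G`. -/
def code (G : Matrix (Fin k) (Fin n) F) : Submodule F (Fin n → F) :=
  LinearMap.range G.vecMulLinear

theorem mem_code_iff (G : Matrix (Fin k) (Fin n) F) (c : Fin n → F) :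
    c ∈ code G ↔ ∃ x, encode G x = c :=
  Iff.rfl

variable [Fintype F] [DecidableEq F]

/-- The fractional plurality
`pl_j(Λ) = (1/|Λ|) max_{α ∈ F} |{x ∈ Λ : c(x)_j = α}|` of coordinate `j`. -/
noncomputable def plurality (G : Matrix (Fin k) (Fin n) F) (j : Fin n)
    (Λ : Finset (Fin k → F)) : ℝ :=
  ((Finset.univ.sup' Finset.univ_nonempty
      fun α : F => (Λ.filter fun x => encode G x j = α).card : ℕ) : ℝ) / (Λ.card : ℝ)

variable (F k n) in
/-- The index set `𝒮₀ = {[n]} × {Λ ⊆ F^k : |Λ| = L}`. -/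
def indexSet (L : ℕ) : Finset (Finset (Fin n) × Finset (Fin k → F)) :=
  {Finset.univ} ×ˢ Finset.powersetCard L Finset.univ

theorem indexSet_nonempty {L : ℕ} (hL : L ≤ Fintype.card F ^ k) :
    (indexSet F k n L).Nonempty :=
  (Finset.singleton_nonempty _).product (powersetCard_nonempty hL)

/-- The process `X(I, Λ) = ∑_{j ∈ I} g_j pl_j(Λ)`, evaluated at the vector `g`. -/
noncomputable def process (G : Matrix (Fin k) (Fin n) F) (g : Fin n → ℝ)
    (p : Finset (Fin n) × Finset (Fin k → F)) : ℝ :=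
  ∑ j ∈ p.1, g j * plurality G j p.2

/-- `max_{(I, Λ) ∈ 𝒮₀} |X(I, Λ)|`, evaluated at the vector `g`. -/
noncomputable def maxProcess (G : Matrix (Fin k) (Fin n) F) {L : ℕ}
    (hL : L ≤ Fintype.card F ^ k) (g : Fin n → ℝ) : ℝ :=
  (indexSet F k n L).sup' (indexSet_nonempty hL) fun p => |process G g p|

/-- `Q = max_{|Λ| = L} ∑_{j ∈ [n]} pl_j(Λ)`. -/
noncomputable def maxPluralitySum (G : Matrix (Fin k) (Fin n) F) {L : ℕ}
    (hL : L ≤ Fintype.card F ^ k) : ℝ :=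
  (Finset.powersetCard L (Finset.univ : Finset (Fin k → F))).sup' (powersetCard_nonempty hL)
    fun Λ => ∑ j, plurality G j Λ

end Definitions

/-- The law of `g = (g_1, …, g_n)`, a vector of independent standard normal variables. -/
noncomputable def gaussianVector (n : ℕ) : Measure (Fin n → ℝ) :=
  Measure.pi fun _ => gaussianReal 0 1

end ListDecoding

/-! The proof is chaining, with nets obtained by random sampling. A uniform `m`-tuple drawn with
replacement from `Λ` has, by Bernstein and a union bound over the at most `L` symbols seen in
coordinate `j`, a largest frequency within `√(pθ) + θ` of `p = pl_j(Λ)`, where `θ` is of order `log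
L / m`. The term `θ` is too costly when `p < θ`: its squares would sum to about `n θ²`. Soft
thresholding at `4θ` sends those coordinates to `0` and leaves a squared error `O(pθ)`
(`sum_sq_softThreshold_sub_le`). Summed over `j`, the mean squared error is `O(Q log L / m)`, so
some tuple achieves it (`exists_tuple_approx`).

The approximation depends only on `m` codewords, so at most `N ^ m` vectors occur, whatever the
number of lists. With `m = 2 ^ t`, consecutive approximations differ by a vector of squared length
`O(Q log L / 2 ^ t)` taken from at most `N ^ (3 * 2 ^ t)` candidates. The factors `2 ^ t` cancel in
the Gaussian maximal inequality (`exists_gaussian_majorant`), and each level costs `O(√(Q log L log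
N))`. The chain starts at `0` and is exact after about `log L` levels, which gives `√(Q log N log³
L)`, stronger than the claim. -/

namespace ListDecoding

/-! ### Largest frequencies under random sampling -/

section MaxFreq

variable {ι A : Type*} [Fintype ι] [DecidableEq A]

/-- The fraction of indices on which `h` takes the value `α`. -/
noncomputable def freq (h : ι → A) (α : A) : ℝ :=
  ((Finset.univ.filter fun i => h i = α).card : ℝ) / (Fintype.card ι : ℝ)

theorem freq_nonneg (h : ι → A) (α : A) : 0 ≤ freq h α := by
  unfold freq; positivity

theorem freq_le_one (h : ι → A) (α : A) : freq h α ≤ 1 :=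
  div_le_one_of_le₀ (by exact_mod_cast Finset.card_filter_le _ _) (by positivity)

theorem freq_eq_zero_of_notMem (h : ι → A) {α : A} (hα : α ∉ Finset.univ.image h) :
    freq h α = 0 := by
  have : (Finset.univ.filter fun i => h i = α) = ∅ := by
    ext i
    simp only [Finset.mem_image, Finset.mem_univ, true_and, not_exists] at hα
    simp [hα i]
  simp [freq, this]

variable {Ω : Type*} [Fintype Ω] [Nonempty Ω]

/-- Exponential moment of the number of samples of colour `α`. -/
theorem sum_exp_freq_le (h : Ω → A) (α : A) {m : ℕ} (hm : 0 < m) {l : ℝ} (hl : |l| ≤ 1) :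
    ∑ y : Fin m → Ω, Real.exp (l * (m * (freq (fun i => h (y i)) α - freq h α))) ≤
      (Fintype.card Ω : ℝ) ^ m * Real.exp (m * freq h α * l ^ 2) := by
  set p := freq h α with hp
  have hp0 : 0 ≤ p := freq_nonneg h α
  have hL : (0 : ℝ) < Fintype.card Ω := by exact_mod_cast Fintype.card_pos
  have hcount : ∀ y : Fin m → Ω, l * (m * (freq (fun i => h (y i)) α - p))
      = (∑ i, (if h (y i) = α then l else 0)) + -(l * m * p) := by
    intro y
    have : (m : ℝ) * freq (fun i => h (y i)) α = ∑ i, (if h (y i) = α then (1 : ℝ) else 0) := by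
      have hm' : (m : ℝ) ≠ 0 := by positivity
      simp only [freq, Fintype.card_fin, Finset.sum_boole]
      field_simp
    have h2 : ∑ i, (if h (y i) = α then l else 0)
        = l * ∑ i, (if h (y i) = α then (1 : ℝ) else 0) := by
      rw [Finset.mul_sum]; simp
    rw [h2, ← this]; ring
  have hone : ∑ ω : Ω, Real.exp (if h ω = α then l else 0)
      = Fintype.card Ω * (1 + p * (Real.exp l - 1)) := by
    have : ∀ ω : Ω, Real.exp (if h ω = α then l else 0)
        = 1 + (if h ω = α then (1 : ℝ) else 0) * (Real.exp l - 1) := by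
      intro ω; split_ifs <;> simp
    simp only [this, Finset.sum_add_distrib, ← Finset.sum_mul, Finset.sum_boole, hp, freq]
    simp
    field_simp
  -- The linear term cancels against the centring; the quadratic one leaves a variance proxy
  -- proportional to `p`.
  have hexp : Real.exp l - 1 ≤ l + l ^ 2 := by
    have := (abs_le.mp (Real.abs_exp_sub_one_sub_id_le hl)).2
    linarith
  have hbase : 0 ≤ 1 + p * (Real.exp l - 1) := by
    have h1 : p ≤ 1 := freq_le_one h α
    nlinarith [Real.exp_pos l]
  calc ∑ y : Fin m → Ω, Real.exp (l * (m * (freq (fun i => h (y i)) α - p)))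
      = (∑ y : Fin m → Ω, ∏ i, Real.exp (if h (y i) = α then l else 0))
          * Real.exp (-(l * m * p)) := by
        rw [Finset.sum_mul]
        refine Finset.sum_congr rfl fun y _ => ?_
        rw [hcount, Real.exp_add, Real.exp_sum]
    _ = (∑ ω : Ω, Real.exp (if h ω = α then l else 0)) ^ m * Real.exp (-(l * m * p)) := by
        rw [Fintype.sum_pow]
    _ = (Fintype.card Ω : ℝ) ^ m * ((1 + p * (Real.exp l - 1)) ^ m * Real.exp (-(l * m * p))) := by
        rw [hone, mul_pow]; ring
    _ ≤ (Fintype.card Ω : ℝ) ^ m * (Real.exp (p * (l + l ^ 2)) ^ m * Real.exp (-(l * m * p))) := by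
        gcongr
        calc 1 + p * (Real.exp l - 1) ≤ 1 + p * (l + l ^ 2) := by gcongr
          _ ≤ _ := by rw [add_comm]; exact Real.add_one_le_exp _
    _ = _ := by
        rw [← Real.exp_nat_mul, ← Real.exp_add]
        congr 2; ring

/-- Choice of the Chernoff parameter under the constraint `l ≤ 1`: the optimal order `√(K / a)` when
it is admissible, and the endpoint `1` otherwise. -/
theorem exists_bernstein_parameter {a K : ℝ} (hK : 0 < K) :
    ∃ l : ℝ, 0 ≤ l ∧ l ≤ 1 ∧ a * l ^ 2 - l * (2 * (√(a * K) + K)) ≤ -K := by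
  have hs := Real.sqrt_nonneg (a * K)
  rcases le_total a K with h | h
  · exact ⟨1, by norm_num, le_rfl, by linarith⟩
  · have ha' : 0 < a := hK.trans_le h
    refine ⟨√(K / a), Real.sqrt_nonneg _, Real.sqrt_le_one.mpr ((div_le_one ha').mpr h), ?_⟩
    have h1 : √(K / a) * √(a * K) = K := by
      rw [← Real.sqrt_mul (by positivity)]
      rw [show K / a * (a * K) = K ^ 2 by field_simp]
      exact Real.sqrt_sq hK.le
    have h2 : a * √(K / a) ^ 2 = K := by
      rw [Real.sq_sqrt (by positivity)]; field_simp
    nlinarith [Real.sqrt_nonneg (K / a)]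

/-- Bernstein's inequality, in the form of a nonnegative function of the sample that exceeds `1`
at every sample whose `α`-frequency deviates and that is exponentially small on average. -/
theorem exists_deviation_majorant (h : Ω → A) (α : A) {m : ℕ} (hm : 0 < m) {K : ℝ} (hK : 0 < K) :
    ∃ E : (Fin m → Ω) → ℝ, (∀ y, 0 ≤ E y) ∧
      (∀ y, √(freq h α * (4 * K / m)) + 4 * K / m < |freq (fun i => h (y i)) α - freq h α| →
        1 ≤ E y) ∧
      ∑ y, E y ≤ (Fintype.card Ω : ℝ) ^ m * (2 * Real.exp (-K)) := by
  set p := freq h α with hp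
  have hp0 : 0 ≤ p := freq_nonneg h α
  have hm' : (0 : ℝ) < m := by exact_mod_cast hm
  obtain ⟨l, hl0, hl1, hl⟩ := exists_bernstein_parameter (a := m * p) hK
  set s := 2 * (√(m * p * K) + K) with hs
  have hsm : s ≤ m * (√(p * (4 * K / m)) + 4 * K / m) := by
    have : (m : ℝ) * √(p * (4 * K / m)) = 2 * √(m * p * K) := by
      rw [show p * (4 * K / m) = (2 / m) ^ 2 * (m * p * K) by field_simp; norm_num,
        Real.sqrt_mul (by positivity), Real.sqrt_sq (by positivity)]
      field_simp
    rw [mul_add, this, hs]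
    field_simp
    linarith
  -- The two-sided Chernoff bound before taking averages: one exponential for each sign of the
  -- deviation.
  refine ⟨fun y => Real.exp (-(l * s)) *
    (Real.exp (l * (m * (freq (fun i => h (y i)) α - p))) +
      Real.exp (-l * (m * (freq (fun i => h (y i)) α - p)))), fun y => by positivity, ?_, ?_⟩
  · intro y hy
    have hy' : s ≤ m * |freq (fun i => h (y i)) α - p| := hsm.trans (by gcongr)
    simp only [mul_add, ← Real.exp_add]
    rcases abs_cases (freq (fun i => h (y i)) α - p) with ⟨h1, -⟩ | ⟨h1, -⟩
    · have := Real.one_le_exp (x := -(l * s) + l * (m * (freq (fun i => h (y i)) α - p))) (by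
        rw [h1] at hy'; nlinarith)
      have := Real.exp_pos (-(l * s) + -l * (m * (freq (fun i => h (y i)) α - p)))
      simp only [mul_add] at *
      linarith
    · have := Real.one_le_exp (x := -(l * s) + -l * (m * (freq (fun i => h (y i)) α - p))) (by
        rw [h1] at hy'; nlinarith)
      have := Real.exp_pos (-(l * s) + l * (m * (freq (fun i => h (y i)) α - p)))
      linarith
  · rw [← Finset.mul_sum, Finset.sum_add_distrib]
    have h1 := sum_exp_freq_le h α hm (l := l) (by rwa [abs_of_nonneg hl0])
    have h2 := sum_exp_freq_le h α hm (l := -l) (by rwa [abs_neg, abs_of_nonneg hl0])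
    rw [neg_sq] at h2
    rw [← hp] at h1 h2
    calc _ ≤ Real.exp (-(l * s)) * ((Fintype.card Ω : ℝ) ^ m * Real.exp (m * p * l ^ 2) +
          (Fintype.card Ω : ℝ) ^ m * Real.exp (m * p * l ^ 2)) := by gcongr
      _ = (Fintype.card Ω : ℝ) ^ m * (2 * Real.exp (m * p * l ^ 2 - l * s)) := by
        rw [sub_eq_add_neg, Real.exp_add]; ring
      _ ≤ _ := by gcongr

variable [Fintype A] [Nonempty A]

/-- The largest fraction of indices on which `h` takes one and the same value. -/
noncomputable def maxFreq (h : ι → A) : ℝ :=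
  ((Finset.univ.sup' Finset.univ_nonempty
      fun α : A => (Finset.univ.filter fun i => h i = α).card : ℕ) : ℝ) / (Fintype.card ι : ℝ)

theorem freq_le_maxFreq (h : ι → A) (α : A) : freq h α ≤ maxFreq h := by
  unfold freq maxFreq
  gcongr
  exact Finset.le_sup' (fun α : A => (Finset.univ.filter fun i => h i = α).card)
    (Finset.mem_univ α)

theorem exists_freq_eq_maxFreq (h : ι → A) : ∃ α, freq h α = maxFreq h := by
  obtain ⟨α, -, hα⟩ := Finset.exists_mem_eq_sup' Finset.univ_nonempty
    (fun α : A => (Finset.univ.filter fun i => h i = α).card)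
  exact ⟨α, by unfold freq maxFreq; rw [hα]⟩

theorem maxFreq_nonneg (h : ι → A) : 0 ≤ maxFreq h := by
  unfold maxFreq; positivity

theorem maxFreq_le_one (h : ι → A) : maxFreq h ≤ 1 := by
  obtain ⟨α, hα⟩ := exists_freq_eq_maxFreq h
  exact hα ▸ freq_le_one h α

theorem inv_card_le_maxFreq [Nonempty ι] (h : ι → A) : 1 / (Fintype.card ι : ℝ) ≤ maxFreq h := by
  obtain ⟨i⟩ := ‹Nonempty ι›
  refine le_trans ?_ (freq_le_maxFreq h (h i))
  unfold freq
  gcongr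
  exact_mod_cast Finset.card_pos.mpr ⟨i, by simp⟩

theorem maxFreq_comp_equiv {κ : Type*} [Fintype κ] (e : κ ≃ ι) (h : ι → A) :
    maxFreq (fun i => h (e i)) = maxFreq h := by
  unfold maxFreq
  have : ∀ α, (Finset.univ.filter fun i => h (e i) = α).card
      = (Finset.univ.filter fun i => h i = α).card := fun α =>
    Finset.card_bij (fun i _ => e i) (by simp) (by simp)
      (fun b hb => ⟨e.symm b, by simpa using hb, by simp⟩)
  simp only [this, Fintype.card_congr e]

/-- If `P` is within the Bernstein error of `p`, then its soft threshold is close to `p`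
in square. -/
theorem sq_softThreshold_sub_le {P p θ : ℝ} (hp : 0 ≤ p) (hθ : 0 ≤ θ) (hP : 0 ≤ P)
    (h : |P - p| ≤ √(p * θ) + θ) :
    (max (P - 4 * θ) 0 - p) ^ 2 ≤ 36 * (p * θ) := by
  obtain ⟨h1, h2⟩ := abs_le.mp h
  have hs := Real.sq_sqrt (mul_nonneg hp hθ)
  have hs0 := Real.sqrt_nonneg (p * θ)
  set s := √(p * θ)
  -- If `p ≤ θ`, then `P ≤ 3θ` is cut to `0` and the error is `p² ≤ pθ`. Otherwise `θ ≤ √(pθ)`, so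
  -- Bernstein error and threshold together are at most `6√(pθ)`.
  rcases le_total p θ with hpt | hpt
  · have hsθ : s ≤ θ := by
      apply Real.sqrt_le_iff.mpr ⟨hθ, by nlinarith⟩
    rw [max_eq_right (by linarith)]
    nlinarith
  · have hsθ : θ ≤ s := Real.le_sqrt_of_sq_le (by nlinarith)
    have : |max (P - 4 * θ) 0 - p| ≤ 6 * s := by
      rcases max_cases (P - 4 * θ) 0 with ⟨h3, h4⟩ | ⟨h3, h4⟩ <;> rw [h3, abs_le] <;>
        constructor <;> linarith
    calc _ = |max (P - 4 * θ) 0 - p| ^ 2 := (sq_abs _).symm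
      _ ≤ (6 * s) ^ 2 := by gcongr
      _ = _ := by rw [mul_pow, hs]; norm_num

/-- The error bound increases with the frequency, so comparing at the two maximising symbols
suffices. -/
theorem abs_maxFreq_sub_le {κ : Type*} [Fintype κ] (h : ι → A) (h' : κ → A) {θ : ℝ}
    (hθ : 0 ≤ θ) (H : ∀ α, |freq h' α - freq h α| ≤ √(freq h α * θ) + θ) :
    |maxFreq h' - maxFreq h| ≤ √(maxFreq h * θ) + θ := by
  have mono : ∀ α, √(freq h α * θ) ≤ √(maxFreq h * θ) := fun α => by
    gcongr; exact freq_le_maxFreq h α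
  obtain ⟨α, hα⟩ := exists_freq_eq_maxFreq h
  obtain ⟨β, hβ⟩ := exists_freq_eq_maxFreq h'
  have h1 := abs_le.mp (H α)
  have h2 := abs_le.mp (H β)
  have h3 := freq_le_maxFreq h' α
  have h4 := freq_le_maxFreq h β
  have h5 := mono α
  have h6 := mono β
  rw [abs_le]
  constructor <;> linarith

/-- The soft-thresholded largest frequency of a random `m`-sample is close in mean square to the
largest frequency of the population. -/
theorem sum_sq_softThreshold_sub_le (h : Ω → A) {m : ℕ} (hm : 0 < m) (hmL : m ≤ Fintype.card Ω)
    (hL : 2 ≤ Fintype.card Ω) :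
    ∑ y : Fin m → Ω,
        (max (maxFreq (fun i => h (y i)) - 64 * Real.logb 2 (Fintype.card Ω) / m) 0
          - maxFreq h) ^ 2 ≤
      (Fintype.card Ω : ℝ) ^ m * (592 * maxFreq h * Real.logb 2 (Fintype.card Ω) / m) := by
  set N := Fintype.card Ω with hN
  set p := maxFreq h with hp
  set ℓ := Real.logb 2 N with hℓ
  have hN2 : (2 : ℝ) ≤ N := by exact_mod_cast hL
  have hm' : (0 : ℝ) < m := by exact_mod_cast hm
  have hℓ1 : 1 ≤ ℓ := by
    rw [hℓ, Real.le_logb_iff_rpow_le (by norm_num) (by linarith)]; simpa using hN2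
  set θ := 4 * (4 * ℓ) / m with hθ
  have hθ0 : 0 ≤ θ := by positivity
  have hp0 : 0 ≤ p := maxFreq_nonneg h
  -- With `K = 4ℓ`, each symbol fails with probability at most `2 / N ^ 4`, small enough for a union
  -- over `N` symbols.
  choose E hE0 hE1 hE2 using fun α => exists_deviation_majorant h α hm (K := 4 * ℓ) (by linarith)
  have pointwise : ∀ y : Fin m → Ω, (max (maxFreq (fun i => h (y i)) - 4 * θ) 0 - p) ^ 2 ≤
      36 * (p * θ) + ∑ α ∈ Finset.univ.image h, E α y := by
    intro y
    have hsum : 0 ≤ ∑ α ∈ Finset.univ.image h, E α y := Finset.sum_nonneg fun α _ => hE0 α y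
    by_cases H : ∀ α, |freq (fun i => h (y i)) α - freq h α| ≤ √(freq h α * θ) + θ
    · have := sq_softThreshold_sub_le hp0 hθ0 (maxFreq_nonneg _)
        (abs_maxFreq_sub_le h (fun i => h (y i)) hθ0 H)
      linarith
    · push Not at H
      obtain ⟨α, hα⟩ := H
      -- A symbol absent from the population is absent from every sample and cannot deviate. The
      -- union bound thus does not involve the alphabet size.
      have hmem : α ∈ Finset.univ.image h := by
        by_contra hne
        have h1 := freq_eq_zero_of_notMem h hne
        have h2 := freq_eq_zero_of_notMem (fun i => h (y i)) (α := α) (by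
          intro hc
          apply hne
          simp only [Finset.mem_image, Finset.mem_univ, true_and] at hc ⊢
          obtain ⟨i, hi⟩ := hc
          exact ⟨y i, hi⟩)
        rw [h1, h2] at hα
        simp at hα
        linarith
      have h1 : 1 ≤ ∑ α ∈ Finset.univ.image h, E α y :=
        (hE1 α y hα).trans (Finset.single_le_sum (fun α _ => hE0 α y) hmem)
      have hp1 : p ≤ 1 := maxFreq_le_one h
      have hP1 : maxFreq (fun i => h (y i)) ≤ 1 := maxFreq_le_one _
      have h2 : (max (maxFreq (fun i => h (y i)) - 4 * θ) 0 - p) ^ 2 ≤ 1 := by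
        rw [sq_le_one_iff_abs_le_one, abs_le]
        have h3 := le_max_right (maxFreq (fun i => h (y i)) - 4 * θ) 0
        have h4 : max (maxFreq (fun i => h (y i)) - 4 * θ) 0 ≤ 1 := max_le (by linarith) (by simp)
        constructor <;> linarith
      have := mul_nonneg hp0 hθ0
      linarith
  have hexp : Real.exp (-(4 * ℓ)) ≤ 1 / (N : ℝ) ^ 4 := by
    have : Real.log N ≤ ℓ := by
      rw [hℓ, Real.logb, le_div_iff₀ (Real.log_pos (by norm_num))]
      have := Real.log_two_lt_d9
      have := Real.log_nonneg (x := (N : ℝ)) (by linarith)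
      nlinarith
    calc Real.exp (-(4 * ℓ)) ≤ Real.exp (-(4 * Real.log N)) := by gcongr
      _ = _ := by
        rw [Real.exp_neg, one_div, show 4 * Real.log N = ((4 : ℕ) : ℝ) * Real.log N by norm_num,
          Real.exp_nat_mul, Real.exp_log (by linarith)]
  have hcard : ((Finset.univ.image h).card : ℝ) ≤ N := by
    exact_mod_cast Finset.card_image_le.trans (by simp [hN])
  -- Both `p` and `θ` are at least `1 / N`, so the failure term is absorbed in one more `pθ`. Then
  -- `37 * 16 = 592`.
  have hsmall : (N : ℝ) * (2 * (1 / (N : ℝ) ^ 4)) ≤ p * θ := by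
    have h1 : 1 / (N : ℝ) ≤ p := inv_card_le_maxFreq h
    have h2 : 1 / (N : ℝ) ≤ θ := by
      rw [hθ]
      have : (m : ℝ) ≤ N := by exact_mod_cast hmL
      gcongr
      linarith
    calc (N : ℝ) * (2 * (1 / (N : ℝ) ^ 4)) = (2 / N) * (1 / N * (1 / N)) := by field_simp
      _ ≤ 1 * (1 / N * (1 / N)) := by
        gcongr
        rw [div_le_one (by linarith)]; exact hN2
      _ ≤ p * θ := by rw [one_mul]; gcongr
  have hthr : 64 * ℓ / m = 4 * θ := by rw [hθ]; ring
  rw [hthr]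
  calc _ ≤ ∑ y : Fin m → Ω, (36 * (p * θ) + ∑ α ∈ Finset.univ.image h, E α y) :=
        Finset.sum_le_sum fun y _ => pointwise y
    _ = (N : ℝ) ^ m * (36 * (p * θ)) + ∑ α ∈ Finset.univ.image h, ∑ y, E α y := by
        rw [Finset.sum_add_distrib, Finset.sum_comm]
        simp [hN]
    _ ≤ (N : ℝ) ^ m * (36 * (p * θ)) +
          ∑ α ∈ Finset.univ.image h, (N : ℝ) ^ m * (2 * Real.exp (-(4 * ℓ))) := by
        gcongr with α hα
        exact hE2 α
    _ = (N : ℝ) ^ m * (36 * (p * θ) +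
          (Finset.univ.image h).card * (2 * Real.exp (-(4 * ℓ)))) := by
        rw [Finset.sum_const, nsmul_eq_mul]; ring
    _ ≤ (N : ℝ) ^ m * (36 * (p * θ) + N * (2 * (1 / (N : ℝ) ^ 4))) := by gcongr
    _ ≤ (N : ℝ) ^ m * (36 * (p * θ) + p * θ) := by gcongr
    _ = _ := by rw [hθ]; ring

end MaxFreq

/-! ### Gaussian maximal inequality -/

section Gaussian

instance (n : ℕ) : IsProbabilityMeasure (gaussianVector n) := by
  unfold gaussianVector; infer_instance

theorem integrable_exp_gaussianReal (t : ℝ) :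
    Integrable (fun x => Real.exp (x * t)) (gaussianReal 0 1) := by
  simpa [mul_comm] using integrable_exp_mul_gaussianReal (μ := 0) (v := 1) t

theorem integral_exp_gaussianReal (t : ℝ) :
    ∫ x, Real.exp (x * t) ∂(gaussianReal 0 1) = Real.exp (t ^ 2 / 2) := by
  have := congrFun (mgf_id_gaussianReal (μ := 0) (v := 1)) t
  simpa [mgf, mul_comm] using this

theorem exp_dot_eq_prod {n : ℕ} (w g : Fin n → ℝ) :
    Real.exp (∑ j, g j * w j) = ∏ j, Real.exp (g j * w j) := Real.exp_sum _ _

theorem integrable_exp_dot {n : ℕ} (w : Fin n → ℝ) :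
    Integrable (fun g => Real.exp (∑ j, g j * w j)) (gaussianVector n) := by
  simp only [exp_dot_eq_prod]
  exact Integrable.fintype_prod (f := fun j x => Real.exp (x * w j))
    fun j => integrable_exp_gaussianReal (w j)

theorem integral_exp_dot {n : ℕ} (w : Fin n → ℝ) :
    ∫ g, Real.exp (∑ j, g j * w j) ∂(gaussianVector n) = Real.exp ((∑ j, w j ^ 2) / 2) := by
  simp only [exp_dot_eq_prod]
  rw [gaussianVector, integral_fintype_prod_eq_prod (f := fun j x => Real.exp (x * w j))]
  simp only [integral_exp_gaussianReal]
  rw [← Real.exp_sum, Finset.sum_div]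

/-- The Gaussian maximal inequality, in the form of an integrable majorant of the whole family. -/
theorem exists_gaussian_majorant {n : ℕ} {ι : Type*} [Fintype ι] (w : ι → Fin n → ℝ) {D M : ℝ}
    (hD : 0 < D) (hM : 1 ≤ M) (hι : (Fintype.card ι : ℝ) ≤ M) :
    ∃ Φ : (Fin n → ℝ) → ℝ, Integrable Φ (gaussianVector n) ∧
      (∀ g i, ∑ j, w i j ^ 2 ≤ D ^ 2 → |∑ j, g j * w i j| ≤ Φ g) ∧
      ∫ g, Φ g ∂(gaussianVector n) ≤ D * √(2 * Real.log (2 * M)) := by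
  classical
  set b := 2 * Real.log (2 * M) with hb
  have hb0 : 0 < b := mul_pos two_pos (Real.log_pos (by linarith))
  set l := √b / D with hl
  have hl0 : 0 < l := div_pos (Real.sqrt_pos.mpr hb0) hD
  have hlD : l ^ 2 * D ^ 2 = b := by
    rw [hl, div_pow, Real.sq_sqrt hb0.le]; field_simp
  -- Vectors that are too long are discarded, so the index type can later consist of all pairs of
  -- tuples.
  set S := Finset.univ.filter fun i => ∑ j, w i j ^ 2 ≤ D ^ 2 with hS
  have expand : ∀ (c : ℝ) (g : Fin n → ℝ) i, ∑ j, g j * (c * w i j) = c * ∑ j, g j * w i j := by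
    intro c g i; rw [Finset.mul_sum]; exact Finset.sum_congr rfl fun j _ => by ring
  have hint : ∀ (c : ℝ) i, Integrable (fun g => Real.exp (c * ∑ j, g j * w i j))
      (gaussianVector n) := fun c i => by
    simpa only [expand] using integrable_exp_dot (fun j => c * w i j)
  have hintg : ∀ (c : ℝ) i, ∫ g, Real.exp (c * ∑ j, g j * w i j) ∂(gaussianVector n)
      = Real.exp (c ^ 2 * (∑ j, w i j ^ 2) / 2) := fun c i => by
    have := integral_exp_dot (fun j => c * w i j)
    simp only [expand, mul_pow, ← Finset.mul_sum] at this
    exact this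
  have hpair : ∀ i, Integrable (fun g => Real.exp (l * ∑ j, g j * w i j) +
      Real.exp (-l * ∑ j, g j * w i j)) (gaussianVector n) := fun i => (hint l i).add (hint (-l) i)
  have hsumint : Integrable (fun g => ∑ i ∈ S, (Real.exp (l * ∑ j, g j * w i j) +
      Real.exp (-l * ∑ j, g j * w i j))) (gaussianVector n) :=
    integrable_finsetSum _ fun i _ => hpair i
  have hsum : ∫ g, ∑ i ∈ S, (Real.exp (l * ∑ j, g j * w i j) +
      Real.exp (-l * ∑ j, g j * w i j)) ∂(gaussianVector n) ≤ Real.exp b := by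
    rw [integral_finsetSum _ fun i _ => hpair i]
    calc _ = ∑ i ∈ S, 2 * Real.exp (l ^ 2 * (∑ j, w i j ^ 2) / 2) := by
          refine Finset.sum_congr rfl fun i _ => ?_
          rw [integral_add (hint l i) (hint (-l) i), hintg, hintg, neg_sq]; ring
      _ ≤ ∑ i ∈ S, 2 * Real.exp (b / 2) := by
          gcongr with i hi
          rw [← hlD]
          gcongr
          exact (Finset.mem_filter.mp hi).2
      _ = S.card * (2 * Real.exp (b / 2)) := by rw [Finset.sum_const, nsmul_eq_mul]
      _ ≤ M * (2 * Real.exp (b / 2)) := by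
          gcongr
          refine le_trans ?_ hι
          exact_mod_cast Finset.card_le_univ S
      _ = Real.exp (b / 2) * Real.exp (b / 2) := by
          have : Real.exp (b / 2) = 2 * M := by
            rw [hb, mul_div_cancel_left₀ _ two_ne_zero, Real.exp_log (by linarith)]
          rw [this]; ring
      _ = Real.exp b := by rw [← Real.exp_add]; congr 1; ring
  -- The tangent bound `y ≤ b - 1 + exp (y - b)` at `y = l * |x|`, with the exponential replaced by
  -- the sum over `S`. That sum has mean at most `exp b`, so the total is at most `b / l = D * √b`.
  refine ⟨fun g => l⁻¹ * ((b - 1) + Real.exp (-b) * ∑ i ∈ S, (Real.exp (l * ∑ j, g j * w i j) +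
      Real.exp (-l * ∑ j, g j * w i j))),
    ((integrable_const _).add (hsumint.const_mul _)).const_mul _, ?_, ?_⟩
  · intro g i hi
    have hiS : i ∈ S := Finset.mem_filter.mpr ⟨Finset.mem_univ i, hi⟩
    beta_reduce
    rw [← div_eq_inv_mul, le_div_iff₀ hl0]
    set x := ∑ j, g j * w i j with hx
    have h1 : Real.exp (l * x) + Real.exp (-l * x) ≤ ∑ i ∈ S,
        (Real.exp (l * ∑ j, g j * w i j) + Real.exp (-l * ∑ j, g j * w i j)) :=
      Finset.single_le_sum (f := fun i => Real.exp (l * ∑ j, g j * w i j) +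
        Real.exp (-l * ∑ j, g j * w i j)) (fun i _ => by positivity) hiS
    have h2 : Real.exp (|x| * l) ≤ Real.exp (l * x) + Real.exp (-l * x) := by
      rcases abs_cases x with ⟨h, -⟩ | ⟨h, -⟩ <;> rw [h]
      · rw [mul_comm]; linarith [Real.exp_pos (-l * x)]
      · rw [show -x * l = -l * x by ring]; linarith [Real.exp_pos (l * x)]
    have h3 : |x| * l - b + 1 ≤ Real.exp (-b) * Real.exp (|x| * l) := by
      rw [← Real.exp_add, neg_add_eq_sub]; exact Real.add_one_le_exp _
    have h4 := mul_le_mul_of_nonneg_left (h2.trans h1) (Real.exp_pos (-b)).le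
    linarith
  · rw [integral_const_mul, integral_add (integrable_const _) (hsumint.const_mul _),
      integral_const_mul]
    simp only [integral_const, probReal_univ, smul_eq_mul, one_mul]
    have h1 : Real.exp (-b) * ∫ g, ∑ i ∈ S, (Real.exp (l * ∑ j, g j * w i j) +
      Real.exp (-l * ∑ j, g j * w i j)) ∂(gaussianVector n) ≤ 1 := by
      calc _ ≤ Real.exp (-b) * Real.exp b := by gcongr
        _ = 1 := by rw [← Real.exp_add]; simp
    calc _ ≤ l⁻¹ * b := by gcongr; linarith
      _ = D * √b := by
        rw [hl, inv_div, div_mul_eq_mul_div, div_eq_iff (Real.sqrt_pos.mpr hb0).ne', mul_assoc,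
          Real.mul_self_sqrt hb0.le]

end Gaussian

/-! ### Approximation by tuples of codewords, and chaining -/

section Chaining

variable {F : Type*} [Field F] {k n : ℕ}

theorem encode_mem_code (G : Matrix (Fin k) (Fin n) F) (x : Fin k → F) : encode G x ∈ code G :=
  (mem_code_iff G _).mpr ⟨x, rfl⟩

variable [Fintype F]

theorem length_pos_of_two_le_card (G : Matrix (Fin k) (Fin n) F)
    (hN : 2 ≤ Nat.card (code G)) : 0 < n := by
  rcases Nat.eq_zero_or_pos n with rfl | h
  · have : Nat.card (code G) ≤ 1 := Finite.card_le_one_iff_subsingleton.mpr inferInstance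
    omega
  · exact h

variable [DecidableEq F]

theorem plurality_eq_maxFreq (G : Matrix (Fin k) (Fin n) F) (j : Fin n)
    (Λ : Finset (Fin k → F)) :
    plurality G j Λ = maxFreq fun x : Λ => encode G x j := by
  have : ∀ α, (Λ.filter fun x => encode G x j = α).card
      = (Finset.univ.filter fun x : Λ => encode G x j = α).card := fun α =>
    Finset.card_bij' (fun x hx => ⟨x, (Finset.mem_filter.mp hx).1⟩) (fun x _ => x)
      (by simp +contextual) (by simp +contextual) (by simp) (by simp)
  simp only [plurality, maxFreq, this, Fintype.card_coe]

/-- The vector of soft-thresholded pluralities of a tuple of codewords. -/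
noncomputable def tuplePlurality {m : ℕ} (τ : ℝ) (u : Fin m → Fin n → F) (j : Fin n) : ℝ :=
  max (maxFreq (fun i => u i j) - τ) 0

/-- Every list is approximated by a short tuple of codewords. -/
theorem exists_tuple_approx (G : Matrix (Fin k) (Fin n) F) (Λ : Finset (Fin k → F))
    {m : ℕ} (hm : 0 < m) (hmL : m ≤ Λ.card) (hL : 2 ≤ Λ.card) :
    ∃ u : Fin m → code G,
      ∑ j, (tuplePlurality (64 * Real.logb 2 Λ.card / m) (fun i => (u i : Fin n → F)) j
        - plurality G j Λ) ^ 2 ≤ 592 * (∑ j, plurality G j Λ) * Real.logb 2 Λ.card / m := by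
  have hcard : Fintype.card Λ = Λ.card := Fintype.card_coe Λ
  have : Nonempty Λ := Fintype.card_pos_iff.mp (by omega)
  set D : (Fin m → Λ) → ℝ := fun y =>
    ∑ j, (tuplePlurality (64 * Real.logb 2 Λ.card / m) (fun i => encode G (y i)) j
        - plurality G j Λ) ^ 2 with hD
  have hsum : ∑ y, D y ≤
      ∑ _y : Fin m → Λ, 592 * (∑ j, plurality G j Λ) * Real.logb 2 Λ.card / m := by
    have key := fun j => sum_sq_softThreshold_sub_le (fun x : Λ => encode G x j) hm
      (by rwa [hcard]) (by rwa [hcard])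
    simp only [hcard, ← plurality_eq_maxFreq] at key
    rw [hD, Finset.sum_comm]
    refine (Finset.sum_le_sum fun j _ => key j).trans_eq ?_
    rw [← Finset.mul_sum, ← Finset.sum_div, ← Finset.sum_mul, ← Finset.mul_sum]
    simp
  obtain ⟨y, -, hy⟩ := Finset.exists_le_of_sum_le Finset.univ_nonempty hsum
  exact ⟨fun i => ⟨encode G (y i), encode_mem_code G _⟩, hy⟩

/-- The list is exactly described by the tuple of all its codewords. -/
theorem exists_tuple_eq (G : Matrix (Fin k) (Fin n) F) (Λ : Finset (Fin k → F)) :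
    ∃ u : Fin Λ.card → code G, ∀ j,
      tuplePlurality 0 (fun i => (u i : Fin n → F)) j = plurality G j Λ := by
  refine ⟨fun i => ⟨encode G (Λ.equivFin.symm i), encode_mem_code G _⟩, fun j => ?_⟩
  rw [tuplePlurality, sub_zero, max_eq_left (maxFreq_nonneg _), plurality_eq_maxFreq]
  exact maxFreq_comp_equiv Λ.equivFin.symm fun x : Λ => encode G x j

/-- The number of codewords used at level `t` of the chaining. -/
def levelSize (L t : ℕ) : ℕ := min (2 ^ t) L

/-- The threshold below which pluralities are dropped at level `t` of the chaining. -/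
noncomputable def levelThreshold (L t : ℕ) : ℝ :=
  if 2 ^ t < L then 64 * Real.logb 2 L / (2 ^ t : ℕ) else 0

/-- Every list has a level-`t` approximation, exact as soon as `2 ^ t` reaches the list size. -/
theorem exists_level_approx (G : Matrix (Fin k) (Fin n) F) {L : ℕ} (hL : 2 ≤ L)
    {Λ : Finset (Fin k → F)} (hΛ : Λ.card = L) {Q : ℝ} (hQ : ∑ j, plurality G j Λ ≤ Q) (t : ℕ) :
    ∃ u : Fin (levelSize L t) → code G,
      ∑ j, (tuplePlurality (levelThreshold L t) (fun i => (u i : Fin n → F)) j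
        - plurality G j Λ) ^ 2 ≤ 592 * Q * Real.logb 2 L / 2 ^ t ∧
      (L ≤ 2 ^ t → ∀ j, tuplePlurality (levelThreshold L t) (fun i => (u i : Fin n → F)) j
        = plurality G j Λ) := by
  have hlog : 0 ≤ Real.logb 2 (L : ℝ) :=
    Real.logb_nonneg (by norm_num) (by exact_mod_cast (by omega : 1 ≤ L))
  have hQ0 : 0 ≤ Q := le_trans (Finset.sum_nonneg fun j _ => by
    rw [plurality_eq_maxFreq]; exact maxFreq_nonneg _) hQ
  by_cases ht : 2 ^ t < L
  · have hsize : levelSize L t = 2 ^ t := min_eq_left ht.le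
    rw [hsize, levelThreshold, if_pos ht]
    subst hΛ
    obtain ⟨u, hu⟩ := exists_tuple_approx G Λ (m := 2 ^ t) (by positivity) ht.le hL
    refine ⟨u, hu.trans ?_, fun h => absurd h (not_le.mpr ht)⟩
    push_cast
    gcongr
  · have hsize : levelSize L t = L := min_eq_right (not_lt.mp ht)
    rw [hsize, levelThreshold, if_neg ht]
    subst hΛ
    obtain ⟨u, hu⟩ := exists_tuple_eq G Λ
    refine ⟨u, ?_, fun _ => hu⟩
    simp only [hu, sub_self]
    simp
    positivity

/-- The threshold `64 * Real.logb 2 L` exceeds every frequency, so the chain starts at `0` and needs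
no separate initial term. -/
theorem tuplePlurality_level_zero {L : ℕ} (hL : 2 ≤ L) (u : Fin (levelSize L 0) → Fin n → F)
    (j : Fin n) : tuplePlurality (levelThreshold L 0) u j = 0 := by
  have hlog : 1 ≤ Real.logb 2 (L : ℝ) := by
    rw [Real.le_logb_iff_rpow_le (by norm_num) (by positivity)]
    simpa using (by exact_mod_cast hL : (2 : ℝ) ≤ L)
  have := maxFreq_le_one fun i => u i j
  rw [tuplePlurality, levelThreshold, if_pos (by omega)]
  refine max_eq_right ?_
  norm_num
  linarith

theorem card_pairs_le {N L : ℕ} (hN : 1 ≤ N) (t : ℕ) :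
    N ^ levelSize L (t + 1) * N ^ levelSize L t ≤ N ^ (3 * 2 ^ t) := by
  rw [← pow_add]
  refine Nat.pow_le_pow_right hN ?_
  have h1 : levelSize L (t + 1) ≤ 2 ^ (t + 1) := min_le_left _ _
  have h2 : levelSize L t ≤ 2 ^ t := min_le_left _ _
  rw [pow_succ] at h1
  omega

/-- One step of the chaining: all increments between two consecutive levels are bounded by one
random variable of small expectation. -/
theorem exists_level_majorant (G : Matrix (Fin k) (Fin n) F) (hN : 2 ≤ Nat.card (code G))
    (L t : ℕ) {R : ℝ} (hR : 0 < R) :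
    ∃ Φ : (Fin n → ℝ) → ℝ, Integrable Φ (gaussianVector n) ∧
      (∀ (g : Fin n → ℝ) (u' : Fin (levelSize L (t + 1)) → code G)
        (u : Fin (levelSize L t) → code G) (p : Fin n → ℝ),
        ∑ j, (tuplePlurality (levelThreshold L (t + 1)) (fun i => (u' i : Fin n → F)) j - p j) ^ 2
          ≤ R / 2 ^ (t + 1) →
        ∑ j, (tuplePlurality (levelThreshold L t) (fun i => (u i : Fin n → F)) j - p j) ^ 2
          ≤ R / 2 ^ t →
        |∑ j, g j * (tuplePlurality (levelThreshold L (t + 1)) (fun i => (u' i : Fin n → F)) j -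
          tuplePlurality (levelThreshold L t) (fun i => (u i : Fin n → F)) j)| ≤ Φ g) ∧
      ∫ g, Φ g ∂(gaussianVector n) ≤ √(24 * R * Real.logb 2 (Nat.card (code G))) := by
  classical
  set N := Nat.card (code G) with hNdef
  have : Fintype (code G) := Fintype.ofFinite _
  have hN' : (2 : ℝ) ≤ N := by exact_mod_cast hN
  have hD : 0 < √(3 * R / 2 ^ t) := Real.sqrt_pos.mpr (by positivity)
  -- The family ranges over all pairs of tuples, so `Φ` does not depend on the list; the target `p`
  -- only certifies that an increment is short.
  obtain ⟨Φ, hΦ, hle, hint⟩ := exists_gaussian_majorant (n := n)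
    (ι := (Fin (levelSize L (t + 1)) → code G) × (Fin (levelSize L t) → code G))
    (fun i j => tuplePlurality (levelThreshold L (t + 1)) (fun a => (i.1 a : Fin n → F)) j -
      tuplePlurality (levelThreshold L t) (fun a => (i.2 a : Fin n → F)) j)
    (M := (N : ℝ) ^ (3 * 2 ^ t)) hD (one_le_pow₀ (by linarith)) (by
      have := card_pairs_le (N := N) (L := L) (by omega) t
      rw [Fintype.card_prod, Fintype.card_fun, Fintype.card_fun, Fintype.card_fin,
        Fintype.card_fin, ← Nat.card_eq_fintype_card (α := code G)]
      exact_mod_cast this)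
  refine ⟨Φ, hΦ, fun g u' u p h' h => hle g (u', u) ?_, hint.trans ?_⟩
  · rw [Real.sq_sqrt (by positivity)]
    calc _ ≤ ∑ j, (2 * (tuplePlurality (levelThreshold L (t + 1))
              (fun i => (u' i : Fin n → F)) j - p j) ^ 2 +
            2 * (tuplePlurality (levelThreshold L t) (fun i => (u i : Fin n → F)) j - p j) ^ 2) := by
          refine Finset.sum_le_sum fun j _ => ?_
          dsimp only
          set a := tuplePlurality (levelThreshold L (t + 1)) (fun i => (u' i : Fin n → F)) j
          set b := tuplePlurality (levelThreshold L t) (fun i => (u i : Fin n → F)) j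
          nlinarith [sq_nonneg (a - p j + (b - p j))]
      _ ≤ 2 * (R / 2 ^ (t + 1)) + 2 * (R / 2 ^ t) := by
          rw [Finset.sum_add_distrib, ← Finset.mul_sum, ← Finset.mul_sum]
          gcongr
      _ = _ := by rw [pow_succ]; field_simp; norm_num
  · have hlog : Real.log N ≤ Real.logb 2 N := by
      rw [Real.logb, le_div_iff₀ (Real.log_pos (by norm_num))]
      have := Real.log_two_lt_d9
      have := Real.log_nonneg (x := (N : ℝ)) (by linarith)
      nlinarith
    -- Since `N ≥ 2`, the extra `log 2` costs at most one more `2 ^ t * log N`.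
    have hlog2 : Real.log (2 * (N : ℝ) ^ (3 * 2 ^ t)) ≤ 4 * 2 ^ t * Real.logb 2 N := by
      rw [Real.log_mul (by norm_num) (by positivity), Real.log_pow]
      have h1 : Real.log 2 ≤ Real.log N := Real.log_le_log (by norm_num) hN'
      have h2 : (1 : ℝ) ≤ 2 ^ t := one_le_pow₀ (by norm_num)
      have h3 : 0 ≤ Real.log N := Real.log_nonneg (by linarith)
      push_cast
      calc Real.log 2 + 3 * 2 ^ t * Real.log N ≤ 4 * 2 ^ t * Real.log N := by nlinarith
        _ ≤ _ := by gcongr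
    rw [← Real.sqrt_mul (by positivity)]
    apply Real.sqrt_le_sqrt
    calc 3 * R / 2 ^ t * (2 * Real.log (2 * (N : ℝ) ^ (3 * 2 ^ t)))
        ≤ 3 * R / 2 ^ t * (2 * (4 * 2 ^ t * Real.logb 2 N)) := by gcongr
      _ = _ := by field_simp; ring

theorem maxPluralitySum_pos (G : Matrix (Fin k) (Fin n) F) (hN : 2 ≤ Nat.card (code G)) {L : ℕ}
    (hL2 : 2 ≤ L) (hL : L ≤ Fintype.card F ^ k) : 0 < maxPluralitySum G hL := by
  obtain ⟨Λ, hΛ⟩ := powersetCard_nonempty (K := F) hL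
  have hn := length_pos_of_two_le_card G hN
  have hcard := (Finset.mem_powersetCard.mp hΛ).2
  have : Nonempty Λ := by
    rw [Finset.nonempty_coe_sort, ← Finset.card_pos]; omega
  have : Nonempty (Fin n) := ⟨⟨0, hn⟩⟩
  refine lt_of_lt_of_le ?_ (Finset.le_sup' (fun Λ => ∑ j, plurality G j Λ) hΛ)
  refine Finset.sum_pos (fun j _ => ?_) Finset.univ_nonempty
  rw [plurality_eq_maxFreq]
  refine lt_of_lt_of_le ?_ (inv_card_le_maxFreq _)
  have : 0 < Fintype.card Λ := Fintype.card_pos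
  positivity

/-- The chaining bound: the maximum of the process is dominated by an integrable function whose
expectation is a sum of one term per level. -/
theorem exists_maxProcess_majorant (G : Matrix (Fin k) (Fin n) F) (hN : 2 ≤ Nat.card (code G))
    {L : ℕ} (hL2 : 2 ≤ L) (hL : L ≤ Fintype.card F ^ k) :
    ∃ Φ : (Fin n → ℝ) → ℝ, Integrable Φ (gaussianVector n) ∧
      (∀ g, maxProcess G hL g ≤ Φ g) ∧
      ∫ g, Φ g ∂(gaussianVector n) ≤ Nat.clog 2 L *
        √(24 * (592 * maxPluralitySum G hL * Real.logb 2 L) *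
          Real.logb 2 (Nat.card (code G))) := by
  set Q := maxPluralitySum G hL with hQdef
  set T := Nat.clog 2 L
  have hQ := maxPluralitySum_pos G hN hL2 hL
  have hlog : 0 < Real.logb 2 (L : ℝ) :=
    Real.logb_pos (by norm_num) (by exact_mod_cast (by omega : 1 < L))
  choose Φ hΦ hle hint using fun t => exists_level_majorant G hN L t
    (R := 592 * Q * Real.logb 2 L) (by positivity)
  refine ⟨fun g => ∑ t ∈ Finset.range T, Φ t g, integrable_finsetSum _ fun t _ => hΦ t,
    fun g => ?_, ?_⟩
  · refine Finset.sup'_le _ _ fun p hp => ?_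
    obtain ⟨hI, hΛ⟩ := Finset.mem_product.mp hp
    have hcard : p.2.card = L := (Finset.mem_powersetCard.mp hΛ).2
    have hPQ : ∑ j, plurality G j p.2 ≤ Q :=
      Finset.le_sup' (fun Λ => ∑ j, plurality G j Λ) hΛ
    choose u hu hexact using exists_level_approx G hL2 hcard hPQ
    set v : ℕ → Fin n → ℝ := fun t =>
      tuplePlurality (levelThreshold L t) (fun i => (u t i : Fin n → F)) with hv
    have htop : ∀ j, v T j = plurality G j p.2 :=
      hexact T (Nat.le_pow_clog (by norm_num) L)
    have htel : process G g p = ∑ t ∈ Finset.range T, ∑ j, g j * (v (t + 1) j - v t j) := by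
      have h0 : ∀ j, v 0 j = 0 := fun j => tuplePlurality_level_zero hL2 _ j
      rw [Finset.sum_comm]
      rw [process, Finset.mem_singleton.mp hI]
      refine Finset.sum_congr rfl fun j _ => ?_
      rw [← Finset.mul_sum, Finset.sum_range_sub (fun t => v t j), h0, htop, sub_zero]
    rw [htel]
    exact (Finset.abs_sum_le_sum_abs _ _).trans
      (Finset.sum_le_sum fun t _ => hle t g _ _ _ (hu (t + 1)) (hu t))
  · rw [integral_finsetSum _ fun t _ => hΦ t]
    refine (Finset.sum_le_sum fun t _ => hint t).trans_eq ?_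
    simp

theorem continuous_maxProcess (G : Matrix (Fin k) (Fin n) F) {L : ℕ}
    (hL : L ≤ Fintype.card F ^ k) : Continuous (maxProcess G hL) := by
  unfold maxProcess process
  refine Continuous.finset_sup'_apply _ fun p _ => ?_
  fun_prop

theorem maxProcess_nonneg (G : Matrix (Fin k) (Fin n) F) {L : ℕ}
    (hL : L ≤ Fintype.card F ^ k) (g : Fin n → ℝ) : 0 ≤ maxProcess G hL g := by
  obtain ⟨p, hp⟩ := indexSet_nonempty (F := F) (n := n) hL
  exact (abs_nonneg _).trans (Finset.le_sup' (fun p => |process G g p|) hp)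

theorem clog_two_le {L : ℕ} (hL : 2 ≤ L) : (Nat.clog 2 L : ℝ) ≤ 2 * Real.logb 2 L := by
  have h1 : (2 : ℝ) ^ (Nat.clog 2 L - 1) ≤ L := by
    exact_mod_cast (Nat.pow_pred_clog_lt_self (by norm_num) (by omega)).le
  have hL' : (2 : ℝ) ≤ L := by exact_mod_cast hL
  have h2 : ((Nat.clog 2 L - 1 : ℕ) : ℝ) ≤ Real.logb 2 L := by
    rw [Real.le_logb_iff_rpow_le (by norm_num) (by linarith), Real.rpow_natCast]
    exact h1
  have h3 : 1 ≤ Real.logb 2 (L : ℝ) := by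
    rw [Real.le_logb_iff_rpow_le (by norm_num) (by linarith)]; simpa using hL'
  have h4 : 1 ≤ Nat.clog 2 L := Nat.clog_pos (by norm_num) hL
  rw [Nat.cast_sub h4] at h2
  push_cast at h2
  linarith

end Chaining

end ListDecoding

/-! ### Assembly of the final bound -/

theorem theorem5p1 :
    ∃ C₃ : ℝ, 0 < C₃ ∧
      ∀ (F : Type*) [Field F] [Fintype F] [DecidableEq F] (k n L : ℕ)
        (G : Matrix (Fin k) (Fin n) F)
        (_hN : 2 ≤ Nat.card (ListDecoding.code G))
        (_hL₂ : 2 ≤ L) (hL : L ≤ Fintype.card F ^ k),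
        Integrable (fun g => ListDecoding.maxProcess G hL g) (ListDecoding.gaussianVector n) ∧
        ∫ g, ListDecoding.maxProcess G hL g ∂(ListDecoding.gaussianVector n) ≤
          C₃ * Real.sqrt (ListDecoding.maxPluralitySum G hL *
            Real.logb 2 (Nat.card (ListDecoding.code G) : ℝ) * Real.logb 2 (L : ℝ) ^ 5) := by
  refine ⟨240, by norm_num, fun F _ _ _ k n L G hN hL2 hL => ?_⟩
  obtain ⟨Φ, hΦ, hle, hint⟩ := ListDecoding.exists_maxProcess_majorant G hN hL2 hL
  have hI : Integrable (fun g => ListDecoding.maxProcess G hL g)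
      (ListDecoding.gaussianVector n) :=
    hΦ.mono' (ListDecoding.continuous_maxProcess G hL).aestronglyMeasurable
      (Filter.Eventually.of_forall fun g => by
        rw [Real.norm_of_nonneg (ListDecoding.maxProcess_nonneg G hL g)]; exact hle g)
  refine ⟨hI, (integral_mono hI hΦ hle).trans (hint.trans ?_)⟩
  have hQ := ListDecoding.maxPluralitySum_pos G hN hL2 hL
  have hclog := ListDecoding.clog_two_le hL2
  have hlog : 1 ≤ Real.logb 2 (L : ℝ) := by
    have : (2 : ℝ) ≤ L := by exact_mod_cast hL2
    rw [Real.le_logb_iff_rpow_le (by norm_num) (by linarith)]; simpa using this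
  have hlogN : 0 ≤ Real.logb 2 (Nat.card (ListDecoding.code G) : ℝ) :=
    Real.logb_nonneg (by norm_num) (by exact_mod_cast (by omega))
  set Q := ListDecoding.maxPluralitySum G hL
  set ℓ := Real.logb 2 (L : ℝ)
  set ν := Real.logb 2 (Nat.card (ListDecoding.code G) : ℝ)
  calc (Nat.clog 2 L : ℝ) * √(24 * (592 * Q * ℓ) * ν)
      ≤ (2 * ℓ) * √(24 * (592 * Q * ℓ) * ν) := by gcongr
    _ = √((2 * ℓ) ^ 2 * (24 * (592 * Q * ℓ) * ν)) := by
        rw [Real.sqrt_mul (sq_nonneg (2 * ℓ)), Real.sqrt_sq (by positivity)]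
    _ ≤ √(240 ^ 2 * (Q * ν * ℓ ^ 5)) := by
        apply Real.sqrt_le_sqrt
        -- Chaining yields `ℓ ^ 3`; the stated power follows from `ℓ ≥ 1`. The constant `240` comes
        -- from `4 * 24 * 592 = 56832 ≤ 240 ^ 2`.
        have h35 : ℓ ^ 3 ≤ ℓ ^ 5 := pow_le_pow_right₀ hlog (by norm_num)
        calc (2 * ℓ) ^ 2 * (24 * (592 * Q * ℓ) * ν) = 56832 * (Q * ν * ℓ ^ 3) := by ring
          _ ≤ 240 ^ 2 * (Q * ν * ℓ ^ 5) := by gcongr; norm_num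
    _ = 240 * √(Q * ν * ℓ ^ 5) := by
        rw [Real.sqrt_mul (by positivity), Real.sqrt_sq (by norm_num)]
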